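/- A permutation of size $n$ is written in one-line notation $\sigma=\sigma(1)\sigma(2)\cdots\sigma(n)$; it is separable if it avoids the patterns $2413$ and $3142$, that is, if no subsequence of $\sigma(1)\cdots\sigma(n)$ is in the same relative order as $2413$ or $3142$. Let $\mathcal{S}_n(2413,3142)$ be the set of separable permutations of size $n$ (for $n=0$, this set consists of the empty permutation), let $S(x)=\sum_{n\ge 0}|\mathcal{S}_n(2413,3142)|\,x^n$, and for $1\le \ell\le n$ let $\mathcal{S}_n^{\ell\mapsto 1}(2413,3142)=\{\sigma\in\mathcal{S}_n(2413,3142):\sigma(\ell)=1\}$. Then, as formal power series in $x$ with coefficients in $\mathbb{Z}[u]$, the series $S(x)+S(xu)-S(x)S(xu)$ is invertible, and \[ g(x,u)=\sum_{n=1}^{\infty}\sum_{\ell=1}^{n}\bigl|\mathcal{S}_n^{\ell\mapsto 1}(2413,3142)\bigr|\,u^{\ell}x^{n} \] satisfies \[ g(x,u)=\frac{x\,u\,S(x)\,S(xu)}{S(x)+S(xu)-S(x)S(xu)}. \] -/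

import Mathlib

/-- The permutation `σ` contains the pattern `τ`: some subsequence of the one-line notation of `σ`
is in the same relative order as `τ`. -/
def ContainsPattern {k n : ℕ} (τ : Equiv.Perm (Fin k)) (σ : Equiv.Perm (Fin n)) : Prop :=
  ∃ f : Fin k ↪o Fin n, ∀ i j : Fin k, σ (f i) < σ (f j) ↔ τ i < τ j

/-- The set of permutations of size `n` that avoid every pattern in `P`. -/
def avoidanceClass {k : ℕ} (P : Set (Equiv.Perm (Fin k))) (n : ℕ) : Set (Equiv.Perm (Fin n)) :=
  {σ | ∀ τ ∈ P, ¬ ContainsPattern τ σ}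

/-- The pattern 2413 in one-line notation, with positions and values shifted to start at `0`. -/
def pattern2413 : Equiv.Perm (Fin 4) where
  toFun := ![1, 3, 0, 2]
  invFun := ![2, 0, 3, 1]
  left_inv := by decide
  right_inv := by decide

/-- The pattern 3142 in one-line notation, with positions and values shifted to start at `0`. -/
def pattern3142 : Equiv.Perm (Fin 4) where
  toFun := ![2, 0, 3, 1]
  invFun := ![1, 3, 0, 2]
  left_inv := by decide
  right_inv := by decide

/-- The separable permutations of size `n`: those avoiding 2413 and 3142. -/
def separablePerms (n : ℕ) : Set (Equiv.Perm (Fin n)) :=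
  avoidanceClass {pattern2413, pattern3142} n

/-- The separable permutations of size `n` whose entry `1` is at position `ℓ`, both counted
from `1` (so the entry is `0` and the position is `ℓ - 1` in `Fin n`). -/
def separablePermsWithOneAt (n ℓ : ℕ) : Set (Equiv.Perm (Fin n)) :=
  {σ | σ ∈ separablePerms n ∧ ∃ i : Fin n, (i : ℕ) + 1 = ℓ ∧ (σ i : ℕ) + 1 = 1}

/-- The univariate generating function `S` of the separable permutations by size, as a power series
in one variable. The empty permutation contributes the constant term. -/
noncomputable def separableSeries : PowerSeries ℤ :=
  PowerSeries.mk fun n => ((separablePerms n).ncard : ℤ)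

open Polynomial in
/-- The series `S(x)` in the ring `ℤ[u]⟦x⟧`. -/
noncomputable def seriesSx : PowerSeries ℤ[X] :=
  PowerSeries.map (Polynomial.C : ℤ →+* ℤ[X]) separableSeries

open Polynomial in
/-- The series `S(xu)` in the ring `ℤ[u]⟦x⟧`, obtained from `S(x)` by replacing `x` by `u x`. -/
noncomputable def seriesSxu : PowerSeries ℤ[X] :=
  PowerSeries.rescale (Polynomial.X : ℤ[X]) seriesSx

open Polynomial in
/-- The series `g(x,u)`, the sum over `n ≥ 1` and `1 ≤ ℓ ≤ n` of the number of separable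
permutations of size `n` with entry `1` at position `ℓ`, times `u ^ ℓ * x ^ n`, in `ℤ[u]⟦x⟧`.
The coefficient of `x ^ 0` is an empty sum. -/
noncomputable def separableByPosOne : PowerSeries ℤ[X] :=
  PowerSeries.mk fun n =>
    ∑ ℓ ∈ Finset.Icc 1 n, ((separablePermsWithOneAt n ℓ).ncard : ℤ[X]) * (Polynomial.X : ℤ[X]) ^ ℓ

/-! Let A and B be the series of separable permutations whose maximum is at or before, respectively
at or after, the entry 1, with u marking the position of 1. Let k be the largest entry up to the
position of 1. Avoiding 3142 forces the entries up to k to precede all larger ones, so the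
permutation is uniquely α ⊕ β with α counted by A and β an arbitrary separable permutation; hence g
= A S(x) (`exists_mem_cutPerms`, `ncard_cutPerms`, `cutPerms_disjoint`). Reversal swaps the two
patterns and exchanges A with B. It puts the β-part in front, where it shifts the position of 1 by
its size, so g = B S(xu).

The maximum and the entry 1 coincide only in size 1, so A + B = g + xu. Multiplying by S(x) S(xu)
eliminates A and B and leaves a linear equation for g. -/

/-- The separable permutations of size `n` with entry `0` at position `p` whose largest entry is
at or before position `p`. -/
def maxBeforeMin (n p : ℕ) : Set (Equiv.Perm (Fin n)) :=
  {σ | σ ∈ separablePermsWithOneAt n (p + 1) ∧ ∃ q : Fin n, (q : ℕ) ≤ p ∧ (σ q : ℕ) + 1 = n}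

/-- The separable permutations of size `n` with entry `0` at position `p` whose largest entry is
at or after position `p`. -/
def maxAfterMin (n p : ℕ) : Set (Equiv.Perm (Fin n)) :=
  {σ | σ ∈ separablePermsWithOneAt n (p + 1) ∧ ∃ q : Fin n, p ≤ (q : ℕ) ∧ (σ q : ℕ) + 1 = n}

theorem mem_separablePermsWithOneAt_succ {n p : ℕ} {σ : Equiv.Perm (Fin n)} :
    σ ∈ separablePermsWithOneAt n (p + 1) ↔
      σ ∈ separablePerms n ∧ ∃ i : Fin n, (i : ℕ) = p ∧ (σ i : ℕ) = 0 := by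
  simp [separablePermsWithOneAt]

theorem mem_separablePerms {n : ℕ} {σ : Equiv.Perm (Fin n)} :
    σ ∈ separablePerms n ↔ ¬ ContainsPattern pattern2413 σ ∧ ¬ ContainsPattern pattern3142 σ := by
  simp [separablePerms, avoidanceClass]

theorem containsPattern_of_strictMono {k n : ℕ} {τ : Equiv.Perm (Fin k)} {σ : Equiv.Perm (Fin n)}
    {f : Fin k → Fin n} (hf : StrictMono f) (h : ∀ i j, σ (f i) < σ (f j) ↔ τ i < τ j) :
    ContainsPattern τ σ :=
  ⟨OrderEmbedding.ofStrictMono f hf, h⟩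

/-! ### Reversal -/

theorem ContainsPattern.revPerm_trans {k n : ℕ} {τ : Equiv.Perm (Fin k)} {σ : Equiv.Perm (Fin n)}
    (h : ContainsPattern τ σ) : ContainsPattern (Fin.revPerm.trans τ) (Fin.revPerm.trans σ) := by
  obtain ⟨f, hf⟩ := h
  refine containsPattern_of_strictMono (f := fun i => (f i.rev).rev) ?_ fun i j => ?_
  · intro i j hij
    simpa using hij
  · simpa using hf i.rev j.rev

theorem revPerm_trans_revPerm_trans {n : ℕ} (σ : Equiv.Perm (Fin n)) :
    Fin.revPerm.trans (Fin.revPerm.trans σ) = σ := by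
  ext i; simp

theorem containsPattern_revPerm_trans_iff {k n : ℕ} {τ : Equiv.Perm (Fin k)}
    {σ : Equiv.Perm (Fin n)} :
    ContainsPattern τ (Fin.revPerm.trans σ) ↔ ContainsPattern (Fin.revPerm.trans τ) σ := by
  constructor <;> intro h <;> simpa only [revPerm_trans_revPerm_trans] using h.revPerm_trans

theorem revPerm_trans_mem_separablePerms {n : ℕ} {σ : Equiv.Perm (Fin n)} :
    Fin.revPerm.trans σ ∈ separablePerms n ↔ σ ∈ separablePerms n := by
  have h : Fin.revPerm.trans pattern2413 = pattern3142 := by decide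
  have h' : Fin.revPerm.trans pattern3142 = pattern2413 := by decide
  rw [mem_separablePerms, mem_separablePerms, containsPattern_revPerm_trans_iff,
    containsPattern_revPerm_trans_iff, h, h', and_comm]

theorem revPerm_trans_mem_separablePermsWithOneAt {n p : ℕ} (hp : p < n)
    {σ : Equiv.Perm (Fin n)} (h : σ ∈ separablePermsWithOneAt n (p + 1)) :
    Fin.revPerm.trans σ ∈ separablePermsWithOneAt n (n - 1 - p + 1) := by
  rw [mem_separablePermsWithOneAt_succ] at h ⊢
  obtain ⟨hσ, i, rfl, hi⟩ := h
  refine ⟨revPerm_trans_mem_separablePerms.2 hσ, i.rev, ?_, by simpa using hi⟩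
  rw [Fin.val_rev]; omega

theorem revPerm_trans_mem_maxAfterMin {n p : ℕ} (hp : p < n)
    {σ : Equiv.Perm (Fin n)} (h : σ ∈ maxBeforeMin n p) :
    Fin.revPerm.trans σ ∈ maxAfterMin n (n - 1 - p) := by
  obtain ⟨hσ, q, hq, hm⟩ := h
  refine ⟨revPerm_trans_mem_separablePermsWithOneAt hp hσ, q.rev, ?_, by simpa using hm⟩
  rw [Fin.val_rev]; omega

theorem revPerm_trans_mem_maxBeforeMin {n p : ℕ} (hp : p < n)
    {σ : Equiv.Perm (Fin n)} (h : σ ∈ maxAfterMin n p) :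
    Fin.revPerm.trans σ ∈ maxBeforeMin n (n - 1 - p) := by
  obtain ⟨hσ, q, hq, hm⟩ := h
  refine ⟨revPerm_trans_mem_separablePermsWithOneAt hp hσ, q.rev, ?_, by simpa using hm⟩
  rw [Fin.val_rev]; omega

theorem revPerm_trans_injective {n : ℕ} :
    Function.Injective fun σ : Equiv.Perm (Fin n) => Fin.revPerm.trans σ :=
  Function.LeftInverse.injective revPerm_trans_revPerm_trans

theorem ncard_separablePermsWithOneAt_rev {n p : ℕ} (hp : p < n) :
    (separablePermsWithOneAt n (n - 1 - p + 1)).ncard =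
      (separablePermsWithOneAt n (p + 1)).ncard := by
  refine le_antisymm ?_ ?_ <;>
    refine Set.ncard_le_ncard_of_injOn _ (fun σ hσ => ?_) revPerm_trans_injective.injOn
      (Set.toFinite _)
  · have := revPerm_trans_mem_separablePermsWithOneAt (by omega) hσ
    rwa [show n - 1 - (n - 1 - p) = p by omega] at this
  · exact revPerm_trans_mem_separablePermsWithOneAt hp hσ

theorem ncard_maxAfterMin_rev {n p : ℕ} (hp : p < n) :
    (maxAfterMin n (n - 1 - p)).ncard = (maxBeforeMin n p).ncard := by
  refine le_antisymm ?_ ?_ <;>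
    refine Set.ncard_le_ncard_of_injOn _ (fun σ hσ => ?_) revPerm_trans_injective.injOn
      (Set.toFinite _)
  · have := revPerm_trans_mem_maxBeforeMin (by omega) hσ
    rwa [show n - 1 - (n - 1 - p) = p by omega] at this
  · exact revPerm_trans_mem_maxAfterMin hp hσ

/-! ### Direct sums -/

/-- The direct sum of two permutations: `β` is placed after and above `α`. -/
def directSum {k m : ℕ} (α : Equiv.Perm (Fin k)) (β : Equiv.Perm (Fin m)) :
    Equiv.Perm (Fin (k + m)) :=
  finSumFinEquiv.permCongr (Equiv.Perm.sumCongr α β)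

@[simp] theorem directSum_castAdd {k m : ℕ} (α : Equiv.Perm (Fin k)) (β : Equiv.Perm (Fin m))
    (i : Fin k) : directSum α β (Fin.castAdd m i) = Fin.castAdd m (α i) := by
  simp [directSum, Equiv.permCongr_apply]

@[simp] theorem directSum_natAdd {k m : ℕ} (α : Equiv.Perm (Fin k)) (β : Equiv.Perm (Fin m))
    (i : Fin m) : directSum α β (Fin.natAdd k i) = Fin.natAdd k (β i) := by
  simp [directSum, Equiv.permCongr_apply]

theorem directSum_val_lt_iff {k m : ℕ} (α : Equiv.Perm (Fin k)) (β : Equiv.Perm (Fin m))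
    (i : Fin (k + m)) : (directSum α β i : ℕ) < k ↔ (i : ℕ) < k := by
  induction i using Fin.addCases <;> simp

theorem directSum_injective {k m : ℕ} :
    Function.Injective fun x : Equiv.Perm (Fin k) × Equiv.Perm (Fin m) => directSum x.1 x.2 := by
  rintro ⟨α, β⟩ ⟨α', β'⟩ h
  have h' : (α, β) = (α', β') :=
    Equiv.Perm.sumCongrHom_injective (finSumFinEquiv.permCongr.injective h)
  exact h'

/-- A permutation of a finite set that maps the first block into itself also preserves the
complement. -/
theorem exists_directSum_eq {k m : ℕ} {σ : Equiv.Perm (Fin (k + m))}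
    (h : ∀ i : Fin (k + m), (i : ℕ) < k → (σ i : ℕ) < k) :
    ∃ (α : Equiv.Perm (Fin k)) (β : Equiv.Perm (Fin m)), directSum α β = σ := by
  obtain ⟨⟨α, β⟩, hαβ⟩ := Equiv.Perm.mem_sumCongrHom_range_of_perm_mapsTo_inl
    (σ := finSumFinEquiv.symm.permCongr σ) (by
      rintro _ ⟨i, rfl⟩
      refine ⟨⟨σ (Fin.castAdd m i), h _ (by simp)⟩, ?_⟩
      rw [← finSumFinEquiv.apply_eq_iff_eq]
      ext
      simp [Equiv.permCongr_apply])
  refine ⟨α, β, finSumFinEquiv.symm.permCongr.injective ?_⟩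
  refine Eq.trans ?_ hαβ
  ext x
  simp [directSum, Equiv.permCongr_apply]

theorem ContainsPattern.directSum_left {l k m : ℕ} {τ : Equiv.Perm (Fin l)}
    {α : Equiv.Perm (Fin k)} (h : ContainsPattern τ α) (β : Equiv.Perm (Fin m)) :
    ContainsPattern τ (directSum α β) := by
  obtain ⟨f, hf⟩ := h
  refine ⟨f.trans (Fin.castAddOrderEmb m), fun i j => ?_⟩
  simpa [Fin.lt_def, -Fin.val_fin_lt] using hf i j

theorem ContainsPattern.directSum_right {l k m : ℕ} {τ : Equiv.Perm (Fin l)}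
    {β : Equiv.Perm (Fin m)} (h : ContainsPattern τ β) (α : Equiv.Perm (Fin k)) :
    ContainsPattern τ (directSum α β) := by
  obtain ⟨f, hf⟩ := h
  refine ⟨f.trans (Fin.natAddOrderEmb k), fun i j => ?_⟩
  simpa using hf i j

/-- A pattern that has an inversion across each cut into two nonempty parts occurs in a direct sum
only inside one of the summands. -/
theorem ContainsPattern.of_directSum {l k m : ℕ} {τ : Equiv.Perm (Fin (l + 1))}
    {α : Equiv.Perm (Fin k)} {β : Equiv.Perm (Fin m)}
    (hτ : ∀ c : Fin l, ∃ i j : Fin (l + 1), i ≤ c.castSucc ∧ c.succ ≤ j ∧ τ j < τ i)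
    (h : ContainsPattern τ (directSum α β)) : ContainsPattern τ α ∨ ContainsPattern τ β := by
  obtain ⟨f, hf⟩ := h
  by_cases h0 : k ≤ (f 0 : ℕ)
  · right
    have hk : ∀ i, k ≤ (f i : ℕ) := fun i => h0.trans (f.monotone (Fin.zero_le i))
    have hg : ∀ i, ∃ j, f i = Fin.natAdd k j := fun i =>
      ⟨⟨f i - k, by have := (f i).2; have := hk i; omega⟩, by
        ext; have := hk i; simp; omega⟩
    choose g hg using hg
    refine containsPattern_of_strictMono (f := g) (fun i j hij => ?_) fun i j => ?_
    · simpa [hg, Fin.lt_def, -Fin.val_fin_lt] using f.strictMono hij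
    · rw [← hf i j, hg, hg]
      simp [Fin.lt_def, -Fin.val_fin_lt]
  by_cases hl : (f (Fin.last l) : ℕ) < k
  · left
    have hk : ∀ i, (f i : ℕ) < k := fun i => lt_of_le_of_lt (f.monotone (Fin.le_last i)) hl
    have hg : ∀ i, ∃ j, f i = Fin.castAdd m j := fun i => ⟨⟨f i, hk i⟩, by ext; simp⟩
    choose g hg using hg
    refine containsPattern_of_strictMono (f := g) (fun i j hij => ?_) fun i j => ?_
    · simpa [hg, Fin.lt_def, -Fin.val_fin_lt] using f.strictMono hij
    · rw [← hf i j, hg, hg]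
      simp [Fin.lt_def, -Fin.val_fin_lt]
  · exfalso
    -- The occurrence starts in the first block and ends in the second, so it crosses at some `c`. A
    -- direct sum has no inversion across the blocks, but `hτ c` demands one.
    have hc : ∃ c : Fin l, (f c.castSucc : ℕ) < k ∧ k ≤ (f c.succ : ℕ) := by
      by_contra! hc
      exact hl (Fin.induction (motive := fun i => (f i : ℕ) < k) (by omega) hc (Fin.last l))
    obtain ⟨c, h1, h2⟩ := hc
    obtain ⟨i, j, hi, hj, hij⟩ := hτ c
    have hi' : (f i : ℕ) < k := lt_of_le_of_lt (f.monotone hi) h1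
    have hj' : k ≤ (f j : ℕ) := h2.trans (f.monotone hj)
    rw [← directSum_val_lt_iff α β] at hi'
    rw [← not_lt, ← directSum_val_lt_iff α β] at hj'
    have := (hf j i).2 hij
    rw [Fin.lt_def] at this
    omega

/-- Both 2413 and 3142 are sum-indecomposable, which `decide` checks cut by cut. -/
theorem directSum_mem_separablePerms {k m : ℕ} {α : Equiv.Perm (Fin k)} {β : Equiv.Perm (Fin m)} :
    directSum α β ∈ separablePerms (k + m) ↔ α ∈ separablePerms k ∧ β ∈ separablePerms m := by
  simp only [mem_separablePerms]
  constructor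
  · rintro ⟨h1, h2⟩
    exact ⟨⟨fun h => h1 (h.directSum_left β), fun h => h2 (h.directSum_left β)⟩,
      fun h => h1 (h.directSum_right α), fun h => h2 (h.directSum_right α)⟩
  · rintro ⟨⟨h1, h2⟩, h3, h4⟩
    exact ⟨fun h => (h.of_directSum (by decide)).elim h1 h3,
      fun h => (h.of_directSum (by decide)).elim h2 h4⟩

/-! ### The decomposition at the largest entry up to the position of the smallest one -/

/-- The separable permutations of size `n` with entry `0` at position `p` that map the first `k`
positions to the `k` smallest entries, the largest of which is at or before position `p`. -/
def cutPerms (n p k : ℕ) : Set (Equiv.Perm (Fin n)) :=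
  {σ | σ ∈ separablePermsWithOneAt n (p + 1) ∧ (∀ i : Fin n, (i : ℕ) < k ↔ (σ i : ℕ) < k) ∧
    ∃ q : Fin n, (q : ℕ) ≤ p ∧ (σ q : ℕ) + 1 = k}

theorem directSum_mem_cutPerms {k m p : ℕ} {α : Equiv.Perm (Fin k)} {β : Equiv.Perm (Fin m)} :
    directSum α β ∈ cutPerms (k + m) p k ↔ α ∈ maxBeforeMin k p ∧ β ∈ separablePerms m := by
  simp only [cutPerms, maxBeforeMin, Set.mem_ofPred_eq, mem_separablePermsWithOneAt_succ,
    directSum_mem_separablePerms, directSum_val_lt_iff, implies_true, true_and]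
  constructor
  · rintro ⟨⟨⟨hα, hβ⟩, i, hi, h0⟩, q, hq, hm⟩
    have hqk : (q : ℕ) < k := by rw [← directSum_val_lt_iff α β]; omega
    have hik : (i : ℕ) < k := by rw [← directSum_val_lt_iff α β]; omega
    obtain ⟨q, rfl⟩ : ∃ q', q = Fin.castAdd m q' := ⟨⟨q, hqk⟩, rfl⟩
    obtain ⟨i, rfl⟩ : ∃ i', i = Fin.castAdd m i' := ⟨⟨i, hik⟩, rfl⟩
    exact ⟨⟨⟨hα, i, by simpa using hi, by simpa using h0⟩, q, by simpa using hq,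
      by simpa using hm⟩, hβ⟩
  · rintro ⟨⟨⟨hα, i, hi, h0⟩, q, hq, hm⟩, hβ⟩
    exact ⟨⟨⟨hα, hβ⟩, Fin.castAdd m i, by simpa using hi, by simpa using h0⟩, Fin.castAdd m q,
      by simpa using hq, by simpa using hm⟩

theorem ncard_cutPerms (k m p : ℕ) :
    (cutPerms (k + m) p k).ncard = (maxBeforeMin k p).ncard * (separablePerms m).ncard := by
  rw [← Set.ncard_prod, ← Set.ncard_image_of_injective _ directSum_injective]
  congr 1
  ext σ
  constructor
  · intro h
    obtain ⟨α, β, rfl⟩ := exists_directSum_eq fun i => (h.2.1 i).1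
    exact ⟨(α, β), directSum_mem_cutPerms.1 h, rfl⟩
  · rintro ⟨⟨α, β⟩, h, rfl⟩
    exact directSum_mem_cutPerms.2 h

/-- The smaller cut `k` lies to the right of position `p`, so every entry up to `p` is below `k`;
the entry `k' - 1` cannot be among them. -/
theorem cutPerms_disjoint {n p k k' : ℕ} (h : k < k') :
    Disjoint (cutPerms n p k) (cutPerms n p k') := by
  rw [Set.disjoint_left]
  rintro σ ⟨hσ, hk, q, -, hqk⟩ ⟨-, -, q', hq', hqk'⟩
  obtain ⟨-, i, hi, h0⟩ := mem_separablePermsWithOneAt_succ.1 hσ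
  have h1 := (hk i).2 (by omega)
  have h2 := (hk q').1 (by omega)
  omega

theorem containsPattern_3142_of_lt {n : ℕ} {σ : Equiv.Perm (Fin n)} {a b c d : Fin n}
    (hab : a < b) (hbc : b < c) (hcd : c < d) (h1 : σ b < σ d) (h2 : σ d < σ a) (h3 : σ a < σ c) :
    ContainsPattern pattern3142 σ := by
  refine containsPattern_of_strictMono (f := ![a, b, c, d]) ?_ fun i j => ?_
  · rw [Fin.strictMono_iff_lt_succ]
    intro i
    fin_cases i <;> simpa
  · rw [Fin.lt_def] at h1 h2 h3
    fin_cases i <;> fin_cases j <;>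
      simp only [pattern3142, Equiv.coe_fn_mk, Fin.reduceFinMk, Fin.isValue, Matrix.cons_val,
        Fin.lt_def] <;> omega

/-- Exactly `k` positions carry values below `k`. Since they precede all others, counting identifies
them with the first `k` positions. -/
theorem lt_iff_val_lt_of_lowerSet {n k : ℕ} (hk : k ≤ n) {σ : Equiv.Perm (Fin n)}
    (h : ∀ i j, (σ i : ℕ) < k → k ≤ (σ j : ℕ) → i < j) (i : Fin n) :
    (i : ℕ) < k ↔ (σ i : ℕ) < k := by
  have hcard : (Finset.univ.filter fun j : Fin n => (σ j : ℕ) < k).card = k := by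
    have hn : (Finset.univ.filter fun j : Fin n => (j : ℕ) < k).card = k := by
      rw [Fin.card_filter_val_lt, min_eq_right hk]
    exact (Finset.card_equiv σ (by simp)).trans hn
  constructor
  · intro hi
    by_contra! hc
    have : (Finset.univ.filter fun j : Fin n => (σ j : ℕ) < k) ⊆ Finset.Iio i := by
      intro j hj
      exact Finset.mem_Iio.2 (h j i (Finset.mem_filter.1 hj).2 hc)
    have := Finset.card_le_card this
    rw [Fin.card_Iio] at this
    omega
  · intro hi
    by_contra! hc
    have : Finset.Iic i ⊆ (Finset.univ.filter fun j : Fin n => (σ j : ℕ) < k) := by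
      intro j hj
      refine Finset.mem_filter.2 ⟨Finset.mem_univ _, ?_⟩
      by_contra! hj'
      exact absurd (h i j hi hj') (not_lt.2 (Finset.mem_Iic.1 hj))
    have := Finset.card_le_card this
    rw [Fin.card_Iic] at this
    omega

theorem exists_mem_cutPerms {n p : ℕ} {σ : Equiv.Perm (Fin n)}
    (hσ : σ ∈ separablePermsWithOneAt n (p + 1)) : ∃ k ≤ n, σ ∈ cutPerms n p k := by
  have hσ' := hσ
  obtain ⟨hsep, i₀, rfl, h0⟩ := mem_separablePermsWithOneAt_succ.1 hσ'
  obtain ⟨q, hq, hmax⟩ := Finset.exists_max_image (Finset.Iic i₀) σ ⟨i₀, by simp⟩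
  rw [Finset.mem_Iic] at hq
  refine ⟨σ q + 1, (σ q).2, hσ, lt_iff_val_lt_of_lowerSet (σ q).2 fun i j hi hj => ?_, q, hq, rfl⟩
  have hj0 : i₀ < j := by
    by_contra! hc
    have := hmax j (by simpa using hc)
    rw [Fin.le_def] at this
    omega
  rcases le_or_gt i i₀ with hi0 | hi0
  · exact hi0.trans_lt hj0
  by_contra! hji
  have hne : σ i ≠ σ q := fun h => by
    have := σ.injective h
    subst this
    exact absurd hq (not_le.2 hi0)
  have hne0 : σ i ≠ σ i₀ := fun h => hi0.ne' (σ.injective h)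
  have hneji : j ≠ i := fun h => by subst h; omega
  rw [Ne, Fin.ext_iff] at hne hne0
  have hqi : q ≠ i₀ := fun h => by subst h; omega
  -- The positions `q < i₀ < j < i` carry an occurrence of 3142.
  refine (mem_separablePerms.1 hsep).2 (containsPattern_3142_of_lt (lt_of_le_of_ne hq hqi) hj0
    (lt_of_le_of_ne hji hneji) ?_ ?_ ?_) <;> rw [Fin.lt_def] <;> omega

theorem ncard_separablePermsWithOneAt (n p : ℕ) :
    (separablePermsWithOneAt n (p + 1)).ncard =
      ∑ x ∈ Finset.HasAntidiagonal.antidiagonal n, (maxBeforeMin x.1 p).ncard * (separablePerms x.2).ncard := by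
  have hU : separablePermsWithOneAt n (p + 1) =
      ⋃ x ∈ Finset.HasAntidiagonal.antidiagonal n, cutPerms n p x.1 := by
    ext σ
    simp only [Set.mem_iUnion, exists_prop, Finset.HasAntidiagonal.mem_antidiagonal]
    constructor
    · intro h
      obtain ⟨k, hk, hσ⟩ := exists_mem_cutPerms h
      exact ⟨(k, n - k), by simp; omega, hσ⟩
    · rintro ⟨x, -, hx⟩
      exact hx.1
  have hD : (Finset.HasAntidiagonal.antidiagonal n : Set (ℕ × ℕ)).PairwiseDisjoint
      fun x => cutPerms n p x.1 := by
    intro x hx y hy hxy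
    rw [Finset.mem_coe, Finset.HasAntidiagonal.mem_antidiagonal] at hx hy
    have : x.1 ≠ y.1 := fun h => hxy (Prod.ext h (by omega))
    rcases lt_or_gt_of_ne this with h | h
    · exact cutPerms_disjoint h
    · exact (cutPerms_disjoint h).symm
  classical
  have hc : (⋃ x ∈ Finset.HasAntidiagonal.antidiagonal n, cutPerms n p x.1).ncard =
      ∑ x ∈ Finset.HasAntidiagonal.antidiagonal n, (cutPerms n p x.1).ncard := by
    simp only [Set.ncard_eq_toFinset_card']
    rw [← Finset.card_biUnion]
    · congr 1
      ext σ
      simp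
    · exact fun x hx y hy hxy => Set.disjoint_toFinset.2 (hD hx hy hxy)
  rw [hU, hc]
  refine Finset.sum_congr rfl fun x hx => ?_
  rw [Finset.HasAntidiagonal.mem_antidiagonal] at hx
  subst hx
  exact ncard_cutPerms _ _ _

/-- The correction term counts the permutation of size 1, the only one in both classes. -/
theorem ncard_add_eq_maxBeforeMin_add_maxAfterMin {n p : ℕ} :
    (separablePermsWithOneAt n (p + 1)).ncard + (if n = 1 ∧ p = 0 then 1 else 0) =
      (maxBeforeMin n p).ncard + (maxAfterMin n p).ncard := by
  have hU : maxBeforeMin n p ∪ maxAfterMin n p = separablePermsWithOneAt n (p + 1) := by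
    ext σ
    constructor
    · rintro (h | h) <;> exact h.1
    · intro h
      obtain ⟨-, i, hi, -⟩ := mem_separablePermsWithOneAt_succ.1 h
      obtain ⟨q, hq⟩ := σ.surjective ⟨n - 1, by have := i.2; omega⟩
      have hm : (σ q : ℕ) + 1 = n := by rw [hq]; have := i.2; simp; omega
      rcases le_total (q : ℕ) p with hqp | hqp
      · exact Or.inl ⟨h, q, hqp, hm⟩
      · exact Or.inr ⟨h, q, hqp, hm⟩
  have hI : (maxBeforeMin n p ∩ maxAfterMin n p).ncard = if n = 1 ∧ p = 0 then 1 else 0 := by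
    split_ifs with h
    · obtain ⟨rfl, rfl⟩ := h
      have hc (τ : Equiv.Perm (Fin 4)) (σ : Equiv.Perm (Fin 1)) : ¬ ContainsPattern τ σ := by
        rintro ⟨f, -⟩
        simpa using Fintype.card_le_of_injective f f.injective
      have : maxBeforeMin 1 0 ∩ maxAfterMin 1 0 = {1} := by
        ext σ
        obtain rfl : σ = 1 := Subsingleton.elim _ _
        simp [maxBeforeMin, maxAfterMin, mem_separablePermsWithOneAt_succ, mem_separablePerms, hc]
      rw [this, Set.ncard_singleton]
    · rw [Set.ncard_eq_zero, Set.eq_empty_iff_forall_notMem]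
      rintro σ ⟨⟨hσ, q, hq, hm⟩, -, q', hq', hm'⟩
      obtain ⟨-, i, hi, h0⟩ := mem_separablePermsWithOneAt_succ.1 hσ
      obtain rfl : q = q' := σ.injective (Fin.ext (by omega))
      obtain rfl : q = i := Fin.ext (by omega)
      have := q.2
      exact h (by omega)
  rw [← hI, ← hU, Set.ncard_union_add_ncard_inter]

/-! ### Generating functions -/

open Polynomial in
/-- The series `∑ c n p * u ^ (p + 1) * x ^ n` over `p < n`. -/
noncomputable def positionSeries (c : ℕ → ℕ → ℕ) : PowerSeries ℤ[X] :=
  PowerSeries.mk fun n => ∑ p ∈ Finset.range n, (c n p : ℤ[X]) * (Polynomial.X : ℤ[X]) ^ (p + 1)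

theorem separableByPosOne_eq :
    separableByPosOne = positionSeries fun n p => (separablePermsWithOneAt n (p + 1)).ncard := by
  ext1 n
  simp only [separableByPosOne, positionSeries, PowerSeries.coeff_mk]
  rw [Finset.range_eq_Ico, Finset.sum_Ico_add' (fun ℓ =>
    ((separablePermsWithOneAt n ℓ).ncard : Polynomial ℤ) * (Polynomial.X : Polynomial ℤ) ^ ℓ)]
  rfl

theorem coeff_seriesSx (n : ℕ) :
    PowerSeries.coeff n seriesSx = ((separablePerms n).ncard : Polynomial ℤ) := by
  simp [seriesSx, separableSeries]

theorem coeff_seriesSxu (n : ℕ) :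
    PowerSeries.coeff n seriesSxu =
      Polynomial.X ^ n * ((separablePerms n).ncard : Polynomial ℤ) := by
  rw [seriesSxu, PowerSeries.coeff_rescale, coeff_seriesSx]

theorem maxBeforeMin_eq_empty {n p : ℕ} (h : n ≤ p) : maxBeforeMin n p = ∅ := by
  rw [Set.eq_empty_iff_forall_notMem]
  rintro σ ⟨hσ, -⟩
  obtain ⟨-, i, hi, -⟩ := mem_separablePermsWithOneAt_succ.1 hσ
  have := i.2
  omega

theorem sum_range_ncard_maxBeforeMin_mul {k n : ℕ} (h : k ≤ n) (w : ℕ → Polynomial ℤ) :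
    ∑ p ∈ Finset.range n, ((maxBeforeMin k p).ncard : Polynomial ℤ) * w p =
      ∑ p ∈ Finset.range k, ((maxBeforeMin k p).ncard : Polynomial ℤ) * w p := by
  refine (Finset.sum_subset (Finset.range_mono h) fun p _ hp => ?_).symm
  rw [Finset.mem_range, not_lt] at hp
  simp [maxBeforeMin_eq_empty hp]

/-- The weight `w` is left free because it is needed both as `u ^ (p + 1)` and, after reversal, as
`u ^ (n - p)`. -/
theorem sum_range_ncard_separablePermsWithOneAt_mul (n : ℕ) (w : ℕ → Polynomial ℤ) :
    ∑ p ∈ Finset.range n, ((separablePermsWithOneAt n (p + 1)).ncard : Polynomial ℤ) * w p =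
      ∑ x ∈ Finset.HasAntidiagonal.antidiagonal n, (∑ p ∈ Finset.range x.1,
        ((maxBeforeMin x.1 p).ncard : Polynomial ℤ) * w p) *
          ((separablePerms x.2).ncard : Polynomial ℤ) := by
  simp only [ncard_separablePermsWithOneAt, Nat.cast_sum, Nat.cast_mul, Finset.sum_mul]
  rw [Finset.sum_comm]
  refine Finset.sum_congr rfl fun x hx => ?_
  rw [← Finset.sum_mul, ← sum_range_ncard_maxBeforeMin_mul (show x.1 ≤ n by rw [Finset.HasAntidiagonal.mem_antidiagonal] at hx; omega),
    Finset.sum_mul]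
  exact Finset.sum_congr rfl fun p _ => by ring

theorem separableByPosOne_eq_maxBeforeMin_mul :
    separableByPosOne = positionSeries (fun n p => (maxBeforeMin n p).ncard) * seriesSx := by
  rw [separableByPosOne_eq]
  ext1 n
  simp only [PowerSeries.coeff_mul, positionSeries, PowerSeries.coeff_mk, coeff_seriesSx]
  exact sum_range_ncard_separablePermsWithOneAt_mul n _

theorem sum_range_mul_pow_reflect (n : ℕ) (c : ℕ → ℕ) :
    ∑ p ∈ Finset.range n, (c p : Polynomial ℤ) * Polynomial.X ^ (p + 1) =
      ∑ p ∈ Finset.range n, (c (n - 1 - p) : Polynomial ℤ) * Polynomial.X ^ (n - p) := by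
  rw [← Finset.sum_range_reflect]
  refine Finset.sum_congr rfl fun p hp => ?_
  rw [Finset.mem_range] at hp
  rw [show n - 1 - p + 1 = n - p by omega]

theorem separableByPosOne_eq_maxAfterMin_mul :
    separableByPosOne = positionSeries (fun n p => (maxAfterMin n p).ncard) * seriesSxu := by
  rw [separableByPosOne_eq]
  ext1 n
  simp only [PowerSeries.coeff_mul, positionSeries, PowerSeries.coeff_mk, coeff_seriesSxu]
  have hrev : ∀ p ∈ Finset.range n,
      ((separablePermsWithOneAt n (n - 1 - p + 1)).ncard : Polynomial ℤ) *
        Polynomial.X ^ (n - p) =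
      ((separablePermsWithOneAt n (p + 1)).ncard : Polynomial ℤ) * Polynomial.X ^ (n - p) :=
    fun p hp => by rw [ncard_separablePermsWithOneAt_rev (Finset.mem_range.1 hp)]
  rw [sum_range_mul_pow_reflect n fun p => (separablePermsWithOneAt n (p + 1)).ncard,
    Finset.sum_congr rfl hrev, sum_range_ncard_separablePermsWithOneAt_mul]
  refine Finset.sum_congr rfl fun x hx => ?_
  rw [Finset.HasAntidiagonal.mem_antidiagonal] at hx
  rw [← mul_assoc]
  congr 1
  rw [sum_range_mul_pow_reflect, Finset.sum_mul]
  refine Finset.sum_congr rfl fun p hp => ?_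
  rw [Finset.mem_range] at hp
  -- The second summand, of size `x.2`, supplies the power of u that turns S(x) into S(xu).
  rw [ncard_maxAfterMin_rev hp, mul_assoc, ← pow_add, show x.1 - p + x.2 = n - p by omega]

theorem separableByPosOne_add_eq :
    separableByPosOne + PowerSeries.X * PowerSeries.C (Polynomial.X : Polynomial ℤ) =
      positionSeries (fun n p => (maxBeforeMin n p).ncard) +
        positionSeries (fun n p => (maxAfterMin n p).ncard) := by
  rw [separableByPosOne_eq]
  ext1 n
  simp only [map_add, positionSeries, PowerSeries.coeff_mk, ← Finset.sum_add_distrib, ← add_mul,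
    ← Nat.cast_add, ← ncard_add_eq_maxBeforeMin_add_maxAfterMin]
  simp only [Nat.cast_add, add_mul, Finset.sum_add_distrib, add_right_inj]
  rw [PowerSeries.coeff_mul_C, PowerSeries.coeff_X]
  by_cases h : n = 1
  · subst h
    simp
  · simp [h]

theorem isUnit_seriesSx_add_seriesSxu_sub_mul :
    IsUnit (seriesSx + seriesSxu - seriesSx * seriesSxu) := by
  have h0 : (separablePerms 0).ncard = 1 := by
    have : separablePerms 0 = {1} := by
      ext σ
      obtain rfl : σ = 1 := Subsingleton.elim _ _
      simp only [mem_separablePerms, Set.mem_singleton_iff, iff_true]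
      exact ⟨fun ⟨f, _⟩ => (f 0).elim0, fun ⟨f, _⟩ => (f 0).elim0⟩
    rw [this, Set.ncard_singleton]
  have hx : PowerSeries.constantCoeff seriesSx = 1 := by
    rw [← PowerSeries.coeff_zero_eq_constantCoeff_apply, coeff_seriesSx, h0, Nat.cast_one]
  have hxu : PowerSeries.constantCoeff seriesSxu = 1 := by
    rw [← PowerSeries.coeff_zero_eq_constantCoeff_apply, coeff_seriesSxu, h0]
    simp
  rw [PowerSeries.isUnit_iff_constantCoeff]
  simp [hx, hxu]

/-- In `ℤ[u]⟦x⟧` the denominator `S(x) + S(xu) - S(x) S(xu)` is invertible, and `g(x,u)` is the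
quotient of `x u S(x) S(xu)` by it. -/
theorem mainTheorem2 :
    IsUnit (seriesSx + seriesSxu - seriesSx * seriesSxu) ∧
    separableByPosOne =
      (PowerSeries.X * PowerSeries.C (Polynomial.X : Polynomial ℤ) * seriesSx * seriesSxu) *
        Ring.inverse (seriesSx + seriesSxu - seriesSx * seriesSxu) := by
  refine ⟨isUnit_seriesSx_add_seriesSxu_sub_mul, ?_⟩
  have h := Ring.mul_inverse_cancel _ isUnit_seriesSx_add_seriesSxu_sub_mul
  have key : separableByPosOne * (seriesSx + seriesSxu - seriesSx * seriesSxu) =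
      PowerSeries.X * PowerSeries.C (Polynomial.X : Polynomial ℤ) * seriesSx * seriesSxu := by
    linear_combination seriesSxu * separableByPosOne_eq_maxBeforeMin_mul +
      seriesSx * separableByPosOne_eq_maxAfterMin_mul -
      seriesSx * seriesSxu * separableByPosOne_add_eq
  rw [← key, mul_assoc, h, mul_one]
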